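/- Let $\mathbb{R}P^r$ denote real projective space (the space of lines through the origin in $\mathbb{R}^{r+1}$, with the quotient topology from $\mathbb{R}^{r+1}\setminus\{0\}$), let $\xi_r$ be the canonical line bundle over $\mathbb{R}P^r$, with total space $\{(\ell,v)\in\mathbb{R}P^r\times\mathbb{R}^{r+1} : v\in \ell\}$, and for a positive integer $k$ let $k\xi_r$ denote the $k$-fold Whitney sum of $\xi_r$ with itself. We say that a real vector bundle has $s$ independent sections if it admits $s$ continuous sections that are linearly independent at every point of the base. Then: 1. $47\xi_{23}$ has $32$ independent sections; 2. $43\xi_{20}$ has $29$ independent sections; 3. $41\xi_{18}$ has $27$ independent sections; 4. $45\xi_{18}$ has $31$ independent sections; 5. $45\xi_{22}$ has $27$ independent sections; 6. $51\xi_{28}$ has $29$ independent sections. -/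

import Mathlib

open Bundle

noncomputable section

/-- Real projective space `ℝPʳ`: the set of lines through the origin of `ℝʳ⁺¹`. -/
def RealProjectiveSpace (r : ℕ) : Type :=
  Projectivization ℝ (EuclideanSpace ℝ (Fin (r + 1)))

namespace RealProjectiveSpace

/-- The line spanned by a nonzero vector, as a point of `ℝPʳ`. -/
def mk {r : ℕ} (x : {x : EuclideanSpace ℝ (Fin (r + 1)) // x ≠ 0}) : RealProjectiveSpace r :=
  Projectivization.mk ℝ x.1 x.2

/-- `ℝPʳ` carries the quotient topology coming from `ℝʳ⁺¹ ∖ {0}`. -/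
instance (r : ℕ) : TopologicalSpace (RealProjectiveSpace r) :=
  TopologicalSpace.coinduced mk inferInstance

/-- A point of `ℝPʳ`, viewed as a one-dimensional subspace of `ℝʳ⁺¹`. -/
def line {r : ℕ} (p : RealProjectiveSpace r) : Submodule ℝ (EuclideanSpace ℝ (Fin (r + 1))) :=
  Projectivization.submodule p

end RealProjectiveSpace

/-- The canonical line bundle `ξ_r` over `ℝPʳ`: the fibre over `p` is the line `p` itself. -/
abbrev CanonicalLineBundle (r : ℕ) (p : RealProjectiveSpace r) : Type := p.line

/-- The total space of `ξ_r` is `{(p, v) | v ∈ p}`, with the subspace topology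
from `ℝPʳ × ℝʳ⁺¹`. -/
instance CanonicalLineBundle.topology (r : ℕ) :
    TopologicalSpace (TotalSpace ℝ (CanonicalLineBundle r)) :=
  TopologicalSpace.induced
    (fun e => ((e.proj, (e.snd : EuclideanSpace ℝ (Fin (r + 1)))) :
      RealProjectiveSpace r × EuclideanSpace ℝ (Fin (r + 1)))) inferInstance

/-- The `k`-fold Whitney sum `kE = E ⊕ ⋯ ⊕ E` of a bundle `E` with itself. -/
abbrev WhitneyMultiple (k : ℕ) {B : Type} (E : B → Type) (b : B) : Type := Fin k → E b

/-- The total space of `kE` is the `k`-fold fibre product over `B` of the total space of `E`,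
with the subspace topology from `B × (total space of E)ᵏ`. -/
instance WhitneyMultiple.topology (k : ℕ) {B : Type} (F : Type) (E : B → Type)
    [TopologicalSpace B] [TopologicalSpace (TotalSpace F E)] :
    TopologicalSpace (TotalSpace (Fin k → F) (WhitneyMultiple k E)) :=
  TopologicalSpace.induced
    (fun e => ((e.proj, fun i => ⟨e.proj, e.snd i⟩) : B × (Fin k → TotalSpace F E)))
    inferInstance

/-- The real vector bundle `E` over `B` (with model fibre `F`) admits `s` independent sections:
there are `s` continuous sections of `E` that are linearly independent at every point of `B`. -/
def HasIndependentSections {B : Type} (F : Type) (E : B → Type)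
    [TopologicalSpace B] [TopologicalSpace (TotalSpace F E)]
    [∀ b, AddCommGroup (E b)] [∀ b, Module ℝ (E b)] (s : ℕ) : Prop :=
  ∃ σ : Fin s → ∀ b, E b,
    (∀ j, Continuous fun b => TotalSpace.mk' F b (σ j b)) ∧
      ∀ b, LinearIndependent ℝ fun j => σ j b

end

/-!
A bilinear map `B : ℝʳ⁺¹ × ℝˢ → ℝᵏ` with `B x y = 0` only for `x = 0` or `y = 0` gives `s`
independent sections of `kξ_r`: at the line through `x` take the vectors `B(x, eⱼ) ⊗ x / ‖x‖²`, which
depend on the line alone since the expression is homogeneous of degree zero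
(`hasIndependentSections_of_nonsingular`). It remains to produce such maps in six triples of
dimensions.

They all come from one twisted multiplication of octonionic polynomials
`x₀ + x₁t + x₂t² + x₃t³` and `y₀ + y₁t + y₂t² + y₃t³`. The ordinary product has seven
coefficients, the last being `x₃y₃`, and is nonsingular because the octonions have no zero divisors.
In `Octonion.twistedProduct` the last coefficient is replaced by the commutator `[x₃, y₃]`, which
takes values in a smaller space. To compensate, the term `y₃x̄₃` is inserted in the coefficient of
`t²`, and signs, conjugations and the order of factors are altered elsewhere. If `[x₃, y₃] = 0`,
then `x₃` and `y₃` lie in a common plane `ℝ + ℝu`, so they associate with every octonion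
(`Octonion.mul_assoc_of_commute`). The remaining equations can then be solved one after the other,
until a positive multiple of a product of two or more octonions vanishes, so that one factor is zero
(`Octonion.eq_zero_or_eq_zero_of_twisted`).

Finally `x₃` and `y₃` are confined to subspaces of dimension 3, 5, 7 or 8 whose commutators fill only
a space of dimension 1, 3, 5 or 7. With `x₀ = 0` this yields the first five triples, and with all
coefficients present the last one.
-/

open scoped Quaternion

/-! ### Sections from nonsingular bilinear maps -/

namespace RealProjectiveSpace

variable {r : ℕ}

theorem rep_ne_zero (p : RealProjectiveSpace r) : Projectivization.rep p ≠ 0 :=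
  Projectivization.rep_nonzero p

/-- A map on `ℝʳ⁺¹` that is constant on the punctured lines and continuous away from the origin
descends to a continuous map on projective space. -/
theorem continuous_rep {Z : Type*} [TopologicalSpace Z] (g : EuclideanSpace ℝ (Fin (r + 1)) → Z)
    (hg : ContinuousOn g {0}ᶜ) (hinv : ∀ (a : ℝ) x, a ≠ 0 → g (a • x) = g x) :
    Continuous fun p : RealProjectiveSpace r => g (Projectivization.rep p) := by
  refine continuous_coinduced_dom.2 ?_
  have : (fun p : RealProjectiveSpace r => g (Projectivization.rep p)) ∘ mk =
      fun x : {x : EuclideanSpace ℝ (Fin (r + 1)) // x ≠ 0} => g x.1 := by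
    funext x
    obtain ⟨a, ha⟩ := Projectivization.exists_smul_eq_mk_rep ℝ x.1 x.2
    change g (Projectivization.mk ℝ x.1 x.2).rep = g x.1
    rw [← ha]
    exact hinv a x.1 a.ne_zero
  rw [this]
  exact continuousOn_iff_continuous_domRestrict.1 hg

end RealProjectiveSpace

theorem continuous_whitneyMultiple_canonicalLineBundle {r k : ℕ}
    (σ : ∀ p : RealProjectiveSpace r, WhitneyMultiple k (CanonicalLineBundle r) p)
    (h : ∀ i, Continuous fun p => (σ p i : EuclideanSpace ℝ (Fin (r + 1)))) :
    Continuous fun p => TotalSpace.mk' (Fin k → ℝ) p (σ p) := by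
  refine continuous_induced_rng.2 (continuous_id.prodMk (continuous_pi fun i => ?_))
  exact continuous_induced_rng.2 (continuous_id.prodMk (h i))

/-- A nonsingular bilinear map `B : ℝʳ⁺¹ × ℝˢ → ℝᵏ` yields the sections `[x] ↦ B(x, eⱼ) ⊗ x / ‖x‖²`
of `kξ_r`, which are independent because `B(x, ·)` is injective. -/
theorem hasIndependentSections_of_bilinear {r s k : ℕ}
    (B : EuclideanSpace ℝ (Fin (r + 1)) →ₗ[ℝ] (Fin s → ℝ) →ₗ[ℝ] (Fin k → ℝ))
    (hB : ∀ x y, B x y = 0 → x = 0 ∨ y = 0) :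
    HasIndependentSections (Fin k → ℝ) (WhitneyMultiple k (CanonicalLineBundle r)) s := by
  let g (j : Fin s) (i : Fin k) (x : EuclideanSpace ℝ (Fin (r + 1))) :
      EuclideanSpace ℝ (Fin (r + 1)) := ((‖x‖ ^ 2)⁻¹ * B x (Pi.single j 1) i) • x
  have hmem (j i) (p : RealProjectiveSpace r) : g j i (Projectivization.rep p) ∈ p.line := by
    refine Submodule.smul_mem _ _ ?_
    change Projectivization.rep p ∈ Projectivization.submodule (p : Projectivization _ _)
    exact (Projectivization.submodule_eq (p : Projectivization _ _)).symm ▸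
      Submodule.mem_span_singleton_self _
  refine ⟨fun j p i => ⟨g j i (Projectivization.rep p), hmem j i p⟩, fun j => ?_, fun p => ?_⟩
  · refine continuous_whitneyMultiple_canonicalLineBundle _ fun i => ?_
    refine RealProjectiveSpace.continuous_rep (g j i) ?_ fun a x ha => ?_
    · have hc : Continuous fun x => B x (Pi.single j 1) i :=
        LinearMap.continuous_of_finiteDimensional
          ((LinearMap.proj i : (Fin k → ℝ) →ₗ[ℝ] ℝ) ∘ₗ B.flip (Pi.single j 1))
      refine ContinuousOn.smul (ContinuousOn.mul (ContinuousOn.inv₀ (by fun_prop) ?_)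
        hc.continuousOn) continuousOn_id
      intro x hx
      exact pow_ne_zero 2 (norm_ne_zero_iff.2 hx)
    · simp only [g, map_smul, LinearMap.smul_apply, Pi.smul_apply, smul_smul, norm_smul, smul_eq_mul,
        mul_pow, mul_inv, Real.norm_eq_abs, sq_abs]
      congr 1
      field_simp
  · rw [Fintype.linearIndependent_iff]
    intro c hc
    set x : EuclideanSpace ℝ (Fin (r + 1)) := Projectivization.rep p
    have hx : x ≠ 0 := RealProjectiveSpace.rep_ne_zero p
    have hzero : B x c = 0 := by
      funext i
      have h1 := congrArg Subtype.val (congrFun hc i)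
      simp only [Finset.sum_apply, Pi.smul_apply, AddSubmonoidClass.coe_finsetSum,
        Submodule.coe_smul, Pi.zero_apply, Submodule.coe_zero, g, smul_smul] at h1
      rw [← Finset.sum_smul, smul_eq_zero, or_iff_left hx] at h1
      have h2 : c = ∑ j, c j • Pi.single j (1 : ℝ) := by
        funext l; simp [Finset.sum_apply, Pi.single_apply]
      have h3 : ∑ j, c j * ((‖x‖ ^ 2)⁻¹ * B x (Pi.single j 1) i) = (‖x‖ ^ 2)⁻¹ * B x c i := by
        conv_rhs => rw [h2]
        simp only [map_sum, map_smul, Finset.sum_apply, Pi.smul_apply, smul_eq_mul, Finset.mul_sum]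
        exact Finset.sum_congr rfl fun j _ => by ring
      have h4 : (‖x‖ ^ 2)⁻¹ ≠ 0 := inv_ne_zero (pow_ne_zero 2 (norm_ne_zero_iff.2 hx))
      rw [h3] at h1
      exact (mul_eq_zero.1 h1).resolve_left h4
    exact congrFun ((hB x c hzero).resolve_left hx)

/-- The coordinate-free form: only the dimensions of the three spaces matter. -/
theorem hasIndependentSections_of_nonsingular {X Y Z : Type*} [AddCommGroup X] [Module ℝ X]
    [Module.Finite ℝ X] [AddCommGroup Y] [Module ℝ Y] [Module.Finite ℝ Y] [AddCommGroup Z]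
    [Module ℝ Z] [Module.Finite ℝ Z] {r s k : ℕ} (hX : Module.finrank ℝ X = r + 1)
    (hY : Module.finrank ℝ Y = s) (hZ : Module.finrank ℝ Z = k) (B : X →ₗ[ℝ] Y →ₗ[ℝ] Z)
    (hB : ∀ x y, B x y = 0 → x = 0 ∨ y = 0) :
    HasIndependentSections (Fin k → ℝ) (WhitneyMultiple k (CanonicalLineBundle r)) s := by
  let eX : EuclideanSpace ℝ (Fin (r + 1)) ≃ₗ[ℝ] X := LinearEquiv.ofFinrankEq _ _ (by simp [hX])
  let eY : (Fin s → ℝ) ≃ₗ[ℝ] Y := LinearEquiv.ofFinrankEq _ _ (by simp [hY])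
  let eZ : Z ≃ₗ[ℝ] (Fin k → ℝ) := LinearEquiv.ofFinrankEq _ _ (by simp [hZ])
  refine hasIndependentSections_of_bilinear
    ((B.compl₁₂ eX.toLinearMap eY.toLinearMap).compr₂ eZ.toLinearMap) fun x y h => ?_
  have h' : eZ (B (eX x) (eY y)) = 0 := h
  simpa using hB _ _ (eZ.map_eq_zero_iff.1 h')

/-! ### Octonions -/

/-- The real octonions, as pairs of quaternions (Cayley–Dickson doubling). -/
@[ext]
structure Octonion where
  /-- The first quaternion coordinate. -/
  fst : ℍ[ℝ]
  /-- The second quaternion coordinate. -/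
  snd : ℍ[ℝ]

namespace Octonion

noncomputable instance : Zero Octonion := ⟨⟨0, 0⟩⟩
noncomputable instance : One Octonion := ⟨⟨1, 0⟩⟩
noncomputable instance : Add Octonion := ⟨fun x y => ⟨x.fst + y.fst, x.snd + y.snd⟩⟩
noncomputable instance : Neg Octonion := ⟨fun x => ⟨-x.fst, -x.snd⟩⟩
noncomputable instance : Sub Octonion := ⟨fun x y => ⟨x.fst - y.fst, x.snd - y.snd⟩⟩
noncomputable instance : Star Octonion := ⟨fun x => ⟨star x.fst, -x.snd⟩⟩
noncomputable instance : SMul ℝ Octonion := ⟨fun t x => ⟨t • x.fst, t • x.snd⟩⟩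

/-- The Cayley–Dickson product `(a, b)(c, d) = (ac - d̄b, da + bc̄)`. -/
noncomputable instance : Mul Octonion :=
  ⟨fun x y => ⟨x.fst * y.fst - star y.snd * x.snd, y.snd * x.fst + x.snd * star y.fst⟩⟩

@[simp] theorem fst_zero : (0 : Octonion).fst = 0 := rfl
@[simp] theorem snd_zero : (0 : Octonion).snd = 0 := rfl
@[simp] theorem fst_one : (1 : Octonion).fst = 1 := rfl
@[simp] theorem snd_one : (1 : Octonion).snd = 0 := rfl
@[simp] theorem fst_add (x y : Octonion) : (x + y).fst = x.fst + y.fst := rfl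
@[simp] theorem snd_add (x y : Octonion) : (x + y).snd = x.snd + y.snd := rfl
@[simp] theorem fst_neg (x : Octonion) : (-x).fst = -x.fst := rfl
@[simp] theorem snd_neg (x : Octonion) : (-x).snd = -x.snd := rfl
@[simp] theorem fst_sub (x y : Octonion) : (x - y).fst = x.fst - y.fst := rfl
@[simp] theorem snd_sub (x y : Octonion) : (x - y).snd = x.snd - y.snd := rfl
@[simp] theorem fst_star (x : Octonion) : (star x).fst = star x.fst := rfl
@[simp] theorem snd_star (x : Octonion) : (star x).snd = -x.snd := rfl
@[simp] theorem fst_smul (t : ℝ) (x : Octonion) : (t • x).fst = t • x.fst := rfl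
@[simp] theorem snd_smul (t : ℝ) (x : Octonion) : (t • x).snd = t • x.snd := rfl
@[simp] theorem fst_mul (x y : Octonion) :
    (x * y).fst = x.fst * y.fst - star y.snd * x.snd := rfl
@[simp] theorem snd_mul (x y : Octonion) :
    (x * y).snd = y.snd * x.fst + x.snd * star y.fst := rfl

noncomputable instance : AddCommGroup Octonion where
  add_assoc x y z := by ext1 <;> simp [add_assoc]
  zero_add x := by ext1 <;> simp
  add_zero x := by ext1 <;> simp
  neg_add_cancel x := by ext1 <;> simp
  add_comm x y := by ext1 <;> simp [add_comm]
  sub_eq_add_neg x y := by ext1 <;> simp [sub_eq_add_neg]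
  nsmul := nsmulRec
  zsmul := zsmulRec

noncomputable instance : NonAssocRing Octonion where
  __ := (inferInstance : AddCommGroup Octonion)
  left_distrib x y z := by ext1 <;> simp [mul_add, add_mul] <;> abel
  right_distrib x y z := by ext1 <;> simp [mul_add, add_mul] <;> abel
  zero_mul x := by ext1 <;> simp
  mul_zero x := by ext1 <;> simp
  one_mul x := by ext1 <;> simp
  mul_one x := by ext1 <;> simp

noncomputable instance : Module ℝ Octonion where
  one_smul x := by ext1 <;> simp
  mul_smul s t x := by ext1 <;> simp [mul_smul]
  smul_zero t := by ext1 <;> simp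
  smul_add t x y := by ext1 <;> simp
  add_smul s t x := by ext1 <;> simp [add_smul]
  zero_smul x := by ext1 <;> simp

instance : IsScalarTower ℝ Octonion Octonion where
  smul_assoc t x y := by ext1 <;> simp [smul_sub]

instance : SMulCommClass ℝ Octonion Octonion where
  smul_comm t x y := by ext1 <;> simp [smul_sub]

noncomputable instance : StarRing Octonion where
  star_involutive x := by ext1 <;> simp
  star_mul x y := by ext1 <;> simp
  star_add x y := by ext1 <;> simp [add_comm]

instance : StarModule ℝ Octonion where
  star_smul t x := by ext1 <;> simp

/-- The octonions as a product of two copies of the quaternions. -/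
noncomputable def equivProd : Octonion ≃ₗ[ℝ] ℍ[ℝ] × ℍ[ℝ] where
  toFun x := (x.fst, x.snd)
  invFun p := ⟨p.1, p.2⟩
  map_add' _ _ := rfl
  map_smul' _ _ := rfl
  left_inv _ := rfl
  right_inv _ := rfl

instance : Module.Finite ℝ Octonion := Module.Finite.equiv equivProd.symm

theorem finrank_eq_eight : Module.finrank ℝ Octonion = 8 := by
  rw [equivProd.finrank_eq, Module.finrank_prod, Quaternion.finrank_eq_four]

/-- The squared norm of an octonion. -/
noncomputable def normSq (x : Octonion) : ℝ :=
  Quaternion.normSq x.fst + Quaternion.normSq x.snd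

theorem normSq_nonneg (x : Octonion) : 0 ≤ normSq x :=
  add_nonneg Quaternion.normSq_nonneg Quaternion.normSq_nonneg

theorem normSq_eq_zero {x : Octonion} : normSq x = 0 ↔ x = 0 := by
  rw [normSq, add_eq_zero_iff_of_nonneg Quaternion.normSq_nonneg Quaternion.normSq_nonneg,
    Quaternion.normSq_eq_zero, Quaternion.normSq_eq_zero]
  exact ⟨fun h => Octonion.ext h.1 h.2, fun h => by simp [h]⟩

theorem normSq_pos {x : Octonion} (hx : x ≠ 0) : 0 < normSq x :=
  (normSq_nonneg x).lt_of_ne fun h => hx (normSq_eq_zero.1 h.symm)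

theorem normSq_star (x : Octonion) : normSq (star x) = normSq x := by
  simp [normSq]

theorem star_mul_mul_cancel (x y : Octonion) : star x * (x * y) = normSq x • y := by
  ext <;> simp [normSq, Quaternion.normSq_def'] <;> ring

theorem mul_star_mul_cancel (x y : Octonion) : x * (star x * y) = normSq x • y := by
  simpa [normSq_star] using star_mul_mul_cancel (star x) y

theorem mul_mul_star_cancel (x y : Octonion) : y * x * star x = normSq x • y := by
  simpa [normSq_star] using congrArg star (mul_star_mul_cancel x (star y))

theorem mul_star_mul_cancel_right (x y : Octonion) : y * star x * x = normSq x • y := by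
  simpa [normSq_star] using mul_mul_star_cancel (star x) y

theorem mul_star_self (x : Octonion) : x * star x = normSq x • (1 : Octonion) := by
  simpa using mul_mul_star_cancel x 1

instance : NoZeroDivisors Octonion where
  eq_zero_or_eq_zero_of_mul_eq_zero {x y} h := by
    have := star_mul_mul_cancel x y
    rw [h, mul_zero, eq_comm, smul_eq_zero, normSq_eq_zero] at this
    exact this

theorem add_star_eq (x : Octonion) : x + star x = (2 * x.fst.re) • (1 : Octonion) := by
  ext <;> simp <;> ring

/-- The imaginary part of `x`, so that `x = Re x + im x`. -/
noncomputable def im (x : Octonion) : Octonion := x - x.fst.re • 1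

theorem eq_re_add_im (x : Octonion) : x = x.fst.re • 1 + im x := by simp [im]

theorem star_im (x : Octonion) : star (im x) = -im x := by
  ext <;> simp [im]

theorem commute_star_right {x y : Octonion} (h : x * y = y * x) : x * star y = star y * x := by
  rw [eq_sub_of_add_eq' (add_star_eq y)]
  simp [mul_sub, sub_mul, h]

/-- Commuting octonions lie in a common plane `ℝ + ℝu`: their imaginary parts are proportional. -/
theorem exists_im_eq_smul_of_commute {x y : Octonion} (h : x * y = y * x) (hx : im x ≠ 0) :
    ∃ t : ℝ, im y = t • im x := by
  have hc : im x * im y = im y * im x := by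
    simp only [im, mul_sub, sub_mul, h, mul_smul_comm, smul_mul_assoc, mul_one, one_mul]
    module
  -- The product of the two imaginary parts is fixed by conjugation, so it is real.
  have hr : star (im x * im y) = im x * im y := by simp [star_im, hc]
  have h2 := add_star_eq (im x * im y)
  rw [hr, ← two_smul ℝ, mul_smul] at h2
  have h3 := smul_right_injective Octonion (two_ne_zero (α := ℝ)) h2
  have h4 := star_mul_mul_cancel (im x) (im y)
  rw [h3, star_im, mul_smul_comm, mul_one] at h4
  have hn := (normSq_pos hx).ne'
  refine ⟨-((normSq (im x))⁻¹ * (im x * im y).fst.re), ?_⟩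
  rw [neg_smul, mul_smul, ← smul_neg, ← smul_neg, h4, smul_smul, inv_mul_cancel₀ hn, one_smul]

/-- The right alternative law for purely imaginary octonions. -/
theorem mul_im_mul_im (a x : Octonion) : a * im x * im x = a * (im x * im x) := by
  have h1 := mul_mul_star_cancel (im x) a
  have h2 := mul_star_self (im x)
  rw [star_im, mul_neg] at h1 h2
  rw [← neg_inj, h1, ← mul_neg, h2, mul_smul_comm, mul_one]

/-- Two commuting octonions associate with every octonion. -/
theorem mul_assoc_of_commute {x y : Octonion} (h : x * y = y * x) (a : Octonion) :
    a * x * y = a * (x * y) := by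
  by_cases hx : im x = 0
  · rw [eq_re_add_im x, hx, add_zero, mul_smul_comm, mul_one, smul_mul_assoc, smul_mul_assoc,
      one_mul, mul_smul_comm]
  · obtain ⟨t, ht⟩ := exists_im_eq_smul_of_commute h hx
    have key (α β : ℝ) : a * (α • 1 + im x) * (β • 1 + t • im x) =
        a * ((α • 1 + im x) * (β • 1 + t • im x)) := by
      simp only [mul_add, add_mul, mul_smul_comm, smul_mul_assoc, mul_one, one_mul,
        mul_im_mul_im, smul_add]
    have := key x.fst.re y.fst.re
    rwa [← ht, ← eq_re_add_im, ← eq_re_add_im] at this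

theorem mul_assoc_of_commute_left {x y : Octonion} (h : x * y = y * x) (a : Octonion) :
    x * (y * a) = x * y * a := by
  have h' : star y * star x = star x * star y := by rw [← star_mul, ← star_mul, h]
  simpa [h] using congrArg star (mul_assoc_of_commute h' (star a))

/-! ### Vanishing of the twisted product -/

/-- The twisted product when `x₀ = 0` and `x₁ ≠ 0`, so that `y₀ = 0`. If `y₃ ≠ 0`, the equations
force `x₁` to be a real multiple of `star x₃`, and then `h3` reads as a positive multiple of
`x₂ * (y₃ * star x₃ * x₁)` being zero; but `x₂ = 0` makes that real multiple vanish. -/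
theorem eq_zero_of_twisted_left_ne_zero {x₁ x₂ x₃ y₁ y₂ y₃ : Octonion} (hx : x₁ ≠ 0)
    (hc : x₃ * y₃ = y₃ * x₃) (h2 : y₁ * star x₁ - y₃ * star x₃ = 0)
    (h3 : x₂ * y₁ - y₂ * x₁ = 0) (h4 : y₃ * x₁ + x₃ * y₁ + star x₂ * y₂ = 0)
    (h5 : x₂ * y₃ + y₂ * x₃ = 0) : y₁ = 0 ∧ y₂ = 0 ∧ y₃ = 0 := by
  have hN1 := normSq_pos hx
  have hc' : y₃ * star x₃ = star x₃ * y₃ := commute_star_right hc.symm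
  -- Once `y₃ = 0`, the first two equations give `y₁ = y₂ = 0`.
  suffices hy3 : y₃ = 0 by
    have hy1 : y₁ = 0 := by simpa [hy3, hx] using h2
    have hy2 : y₂ = 0 := by simpa [hy1, hx] using h3
    exact ⟨hy1, hy2, hy3⟩
  by_contra hy3
  have hx3 : x₃ ≠ 0 := by
    rintro rfl
    have hy1 : y₁ = 0 := by simpa [hx] using h2
    have hy2 : y₂ = 0 := by simpa [hy1, hx] using h3
    exact hy3 (by simpa [hy1, hy2, hx] using h4)
  have hN3 := normSq_pos hx3
  set w := y₃ * star x₃ with hw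
  have hw0 : w ≠ 0 := mul_ne_zero hy3 (by simpa using hx3)
  have e1 : normSq x₁ • y₁ = w * x₁ := by
    rw [← mul_star_mul_cancel_right, sub_eq_zero.1 h2]
  have e2 : normSq x₃ • y₂ = -(x₂ * w) := by
    rw [← mul_mul_star_cancel, eq_neg_of_add_eq_zero_right h5, neg_mul, mul_assoc_of_commute hc']
  have hxw : x₃ * w = normSq x₃ • y₃ := by rw [hc', mul_star_mul_cancel]
  have hwx : w * x₃ = normSq x₃ • y₃ := by rw [hw, mul_star_mul_cancel_right]
  have f1 : normSq x₁ • (x₃ * y₁) = normSq x₃ • (y₃ * x₁) := by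
    rw [← mul_smul_comm, e1, mul_assoc_of_commute_left (hxw.trans hwx.symm), hxw, smul_mul_assoc]
  have f2 : normSq x₃ • (star x₂ * y₂) = -(normSq x₂ • w) := by
    rw [← mul_smul_comm, e2, mul_neg, star_mul_mul_cancel]
  have f3 : y₃ * ((normSq x₃ * (normSq x₁ + normSq x₃)) • x₁ -
      (normSq x₁ * normSq x₂) • star x₃) = 0 := by
    rw [mul_sub, mul_smul_comm, mul_smul_comm, ← hw]
    linear_combination (norm := module)
      (normSq x₃ * normSq x₁) • h4 - normSq x₃ • f1 - normSq x₁ • f2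
  -- Hence `x₁` is a real multiple of `star x₃`, and everything in sight associates.
  have f4 := sub_eq_zero.1 ((mul_eq_zero.1 f3).resolve_left hy3)
  have hK : 0 < normSq x₃ * (normSq x₁ + normSq x₃) := by positivity
  obtain ⟨c, hc1⟩ : ∃ c : ℝ, x₁ = c • star x₃ :=
    ⟨(normSq x₃ * (normSq x₁ + normSq x₃))⁻¹ * (normSq x₁ * normSq x₂), by
      rw [mul_smul, ← f4, smul_smul, inv_mul_cancel₀ hK.ne', one_smul]⟩
  have hws : w * x₁ = x₁ * w := by
    rw [hc1, mul_smul_comm, smul_mul_assoc,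
      commute_star_right (hwx.trans hxw.symm)]
  have f5 : (normSq x₁ + normSq x₃) • (x₂ * (w * x₁)) = 0 := by
    have g1 : normSq x₁ • (x₂ * y₁) = x₂ * (w * x₁) := by rw [← mul_smul_comm, e1]
    have g2 : normSq x₃ • (y₂ * x₁) = -(x₂ * (w * x₁)) := by
      rw [← smul_mul_assoc, e2, neg_mul, mul_assoc_of_commute hws]
    linear_combination (norm := module)
      (normSq x₁ * normSq x₃) • h3 - normSq x₃ • g1 + normSq x₁ • g2
  have hx2 : x₂ = 0 := by
    simpa [(add_pos hN1 hN3).ne', hw0, hx] using f5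
  rw [hx2, normSq_eq_zero.2 rfl, mul_zero, zero_smul] at f4
  exact hx ((smul_eq_zero.1 f4).resolve_left hK.ne')

/-- The twisted product when `x₀ = x₁ = 0` and `x₂ ≠ 0`. Solving successively for `y₀`, `y₁`, `y₂`
turns the last equation into a positive multiple of `x₂ * y₃` being zero. -/
theorem eq_zero_of_twisted_left_eq_zero {x₂ x₃ y₀ y₁ y₂ y₃ : Octonion} (hx : x₂ ≠ 0)
    (hc : x₃ * y₃ = y₃ * x₃) (h2 : star x₂ * y₀ - y₃ * star x₃ = 0)
    (h3 : x₂ * y₁ + y₀ * star x₃ = 0) (h4 : x₃ * y₁ + star x₂ * y₂ = 0)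
    (h5 : x₂ * y₃ + y₂ * x₃ = 0) : y₀ = 0 ∧ y₁ = 0 ∧ y₂ = 0 ∧ y₃ = 0 := by
  have hN2 := normSq_pos hx
  have hN2' := hN2.ne'
  have hc' : y₃ * star x₃ = star x₃ * y₃ := commute_star_right hc.symm
  suffices hy3 : y₃ = 0 by
    have hy0 : y₀ = 0 := by simpa [hy3, hx] using h2
    have hy1 : y₁ = 0 := by simpa [hy0, hx] using h3
    have hy2 : y₂ = 0 := by simpa [hy1, hx] using h4
    exact ⟨hy0, hy1, hy2, hy3⟩
  set w := y₃ * star x₃ with hw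
  have hxw : x₃ * w = normSq x₃ • y₃ := by rw [hc', mul_star_mul_cancel]
  have hwx : w * x₃ = normSq x₃ • y₃ := by rw [hw, mul_star_mul_cancel_right]
  have hws : w * star x₃ = star x₃ * w := commute_star_right (hwx.trans hxw.symm)
  have e0 : normSq x₂ • y₀ = x₂ * w := by rw [← mul_star_mul_cancel, sub_eq_zero.1 h2]
  have e1 : normSq x₂ • y₁ = -(w * star x₃) := by
    apply smul_right_injective _ hN2'
    simp only
    conv_lhs => rw [← star_mul_mul_cancel, mul_smul_comm (normSq x₂) x₂ y₁,
      eq_neg_of_add_eq_zero_left h3, smul_neg, mul_neg, ← smul_mul_assoc, e0,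
      mul_assoc_of_commute hws, star_mul_mul_cancel]
    rw [smul_neg]
  have e2 : normSq x₂ • normSq x₂ • y₂ = normSq x₃ • (x₂ * w) := by
    rw [← mul_star_mul_cancel x₂ y₂, eq_neg_of_add_eq_zero_right h4, mul_neg, smul_neg,
      ← mul_smul_comm, ← mul_smul_comm, e1, hws, mul_neg, mul_star_mul_cancel, mul_neg, neg_neg,
      mul_smul_comm]
  have e3 : normSq x₂ • normSq x₂ • (y₂ * x₃) = (normSq x₃ * normSq x₃) • (x₂ * y₃) := by
    rw [← smul_mul_assoc, ← smul_mul_assoc, e2, smul_mul_assoc,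
      mul_assoc_of_commute (hwx.trans hxw.symm), hwx, mul_smul_comm, smul_smul]
  have e4 : (normSq x₂ * normSq x₂ + normSq x₃ * normSq x₃) • (x₂ * y₃) = 0 := by
    linear_combination (norm := module) (normSq x₂ * normSq x₂) • h5 - e3
  have hK : 0 < normSq x₂ * normSq x₂ + normSq x₃ * normSq x₃ :=
    add_pos_of_pos_of_nonneg (mul_pos hN2 hN2) (mul_self_nonneg _)
  simpa [hK.ne', hx] using e4

/-- The twisted product when `x₀ ≠ 0`, so that `y₀ = y₁ = 0`. If `y₂ ≠ 0`, solving successively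
for `x₀`, `x₁`, `x₂` turns the last equation into a positive multiple of `y₂ * x₃` being zero, and
`x₃ = 0` forces `x₀ = 0`. -/
theorem eq_zero_of_twisted_right {x₀ x₁ x₂ x₃ y₂ y₃ : Octonion} (hx : x₀ ≠ 0)
    (hc : x₃ * y₃ = y₃ * x₃) (h2 : y₃ * star x₃ + star y₂ * x₀ = 0)
    (h3 : y₂ * x₁ - x₀ * star y₃ = 0) (h4 : y₃ * x₁ + star x₂ * y₂ = 0)
    (h5 : x₂ * y₃ + y₂ * x₃ = 0) : y₂ = 0 ∧ y₃ = 0 := by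
  suffices hy2 : y₂ = 0 by
    exact ⟨hy2, by simpa [hy2, hx] using h3⟩
  by_contra hy2
  have hM2 := normSq_pos hy2
  have hM2' := hM2.ne'
  have hc' : y₃ * star x₃ = star x₃ * y₃ := commute_star_right hc.symm
  have hc'' : x₃ * star y₃ = star y₃ * x₃ := commute_star_right hc
  set w := y₃ * star x₃ with hw
  have hws : w * star y₃ = normSq y₃ • star x₃ := by rw [hc', mul_mul_star_cancel]
  have hsw : star y₃ * w = normSq y₃ • star x₃ := by rw [hw, star_mul_mul_cancel]
  have e0 : normSq y₂ • x₀ = -(y₂ * w) := by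
    rw [← mul_star_mul_cancel, eq_neg_of_add_eq_zero_right h2, mul_neg]
  have e1 : normSq y₂ • x₁ = -(normSq y₃ • star x₃) := by
    apply smul_right_injective _ hM2'
    simp only
    conv_lhs => rw [← star_mul_mul_cancel, mul_smul_comm (normSq y₂) y₂ x₁,
      sub_eq_zero.1 h3, ← smul_mul_assoc, e0, neg_mul,
      mul_assoc_of_commute (hws.trans hsw.symm), hws, mul_neg, star_mul_mul_cancel]
    rw [smul_neg]
  have e1' : normSq y₂ • star x₁ = -(normSq y₃ • x₃) := by
    simpa using congrArg star e1
  have e2 : normSq y₂ • x₂ = -(y₂ * (star x₁ * star y₃)) := by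
    have := mul_mul_star_cancel y₂ (star x₂)
    rw [eq_neg_of_add_eq_zero_right h4] at this
    simpa using (congrArg star this).symm
  have e3 : normSq y₂ • normSq y₂ • x₂ = normSq y₃ • (y₂ * (x₃ * star y₃)) := by
    rw [e2, smul_neg, ← mul_smul_comm, ← smul_mul_assoc, e1', neg_mul, mul_neg, neg_neg,
      smul_mul_assoc, mul_smul_comm]
  have hp : x₃ * star y₃ * y₃ = normSq y₃ • x₃ := mul_star_mul_cancel_right _ _
  have hp' : y₃ * (x₃ * star y₃) = normSq y₃ • x₃ := by rw [hc'', mul_star_mul_cancel]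
  have e4 : normSq y₂ • normSq y₂ • (x₂ * y₃) = (normSq y₃ * normSq y₃) • (y₂ * x₃) := by
    rw [← smul_mul_assoc, ← smul_mul_assoc, e3, smul_mul_assoc,
      mul_assoc_of_commute (hp.trans hp'.symm), hp, mul_smul_comm, smul_smul]
  have e5 : (normSq y₂ * normSq y₂ + normSq y₃ * normSq y₃) • (y₂ * x₃) = 0 := by
    linear_combination (norm := module) (normSq y₂ * normSq y₂) • h5 - e4
  have hK : 0 < normSq y₂ * normSq y₂ + normSq y₃ * normSq y₃ :=
    add_pos_of_pos_of_nonneg (mul_pos hM2 hM2) (mul_self_nonneg _)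
  have hx3 : x₃ = 0 := by simpa [hK.ne', hy2] using e5
  have : x₀ = 0 := by simpa [hw, hx3, hM2'] using e0
  exact hx this

/-- Nonsingularity of the twisted product. As for polynomials, the lowest nonzero coefficients are
treated first; each way of placing them is one of the three preceding lemmas. -/
theorem eq_zero_or_eq_zero_of_twisted {x₀ x₁ x₂ x₃ y₀ y₁ y₂ y₃ : Octonion}
    (hc : x₃ * y₃ = y₃ * x₃) (h0 : x₀ * y₀ = 0) (h1 : x₁ * y₀ + x₀ * y₁ = 0)
    (h2 : y₁ * star x₁ - y₃ * star x₃ + star x₂ * y₀ - star y₂ * x₀ = 0)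
    (h3 : x₂ * y₁ - y₂ * x₁ + y₀ * star x₃ + x₀ * star y₃ = 0)
    (h4 : y₃ * x₁ + x₃ * y₁ + star x₂ * y₂ = 0) (h5 : x₂ * y₃ + y₂ * x₃ = 0) :
    (x₀ = 0 ∧ x₁ = 0 ∧ x₂ = 0 ∧ x₃ = 0) ∨ (y₀ = 0 ∧ y₁ = 0 ∧ y₂ = 0 ∧ y₃ = 0) := by
  by_cases hx0 : x₀ = 0
  · subst hx0
    by_cases hx1 : x₁ = 0
    · subst hx1
      by_cases hx2 : x₂ = 0
      · subst hx2
        refine or_iff_not_imp_left.2 fun hx3 => ?_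
        replace hx3 : x₃ ≠ 0 := by simpa using hx3
        have hy3 : y₃ = 0 := by simpa [hx3] using h2
        exact ⟨by simpa [hx3] using h3, by simpa [hx3] using h4, by simpa [hx3] using h5, hy3⟩
      · refine .inr (eq_zero_of_twisted_left_eq_zero hx2 hc ?_ (by simpa using h3)
          (by simpa using h4) h5)
        rw [← h2]; simp; abel
    · have hy0 : y₀ = 0 := by simpa [hx1] using h1
      subst hy0
      exact .inr ⟨rfl, eq_zero_of_twisted_left_ne_zero hx1 hc (by simpa using h2)
        (by simpa using h3) h4 h5⟩
  · have hy0 : y₀ = 0 := by simpa [hx0] using h0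
    subst hy0
    have hy1 : y₁ = 0 := by simpa [hx0] using h1
    subst hy1
    refine .inr ⟨rfl, rfl, eq_zero_of_twisted_right hx0 hc ?_ ?_ (by simpa using h4) h5⟩
    · rw [← neg_eq_zero, ← h2]; simp; abel
    · rw [← neg_eq_zero, ← h3]; simp; abel

section Bilinear

variable {P P' Q : Type*} [AddCommGroup P] [Module ℝ P] [AddCommGroup P'] [Module ℝ P']
  [AddCommGroup Q] [Module ℝ Q]

/-- The twisted polynomial product of `(x₀, …, x₃)` and `(y₀, …, y₃)`, whose last component is the
commutator of `x₃` and `y₃`. The last coefficients are confined to the subspaces parametrized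
by `ι` and `κ`, and only the image under `ρ` of the commutator is recorded. -/
noncomputable def twistedProduct (ι : P →ₗ[ℝ] Octonion) (κ : P' →ₗ[ℝ] Octonion)
    (ρ : Octonion →ₗ[ℝ] Q) :
    (Octonion × Octonion × Octonion × P) →ₗ[ℝ] (Octonion × Octonion × Octonion × P') →ₗ[ℝ]
      (Octonion × Octonion × Octonion × Octonion × Octonion × Octonion × Q) :=
  LinearMap.mk₂ ℝ
    (fun x y =>
      (x.1 * y.1,
        x.2.1 * y.1 + x.1 * y.2.1,
        y.2.1 * star x.2.1 - κ y.2.2.2 * star (ι x.2.2.2) + star x.2.2.1 * y.1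
          - star y.2.2.1 * x.1,
        x.2.2.1 * y.2.1 - y.2.2.1 * x.2.1 + y.1 * star (ι x.2.2.2) + x.1 * star (κ y.2.2.2),
        κ y.2.2.2 * x.2.1 + ι x.2.2.2 * y.2.1 + star x.2.2.1 * y.2.2.1,
        x.2.2.1 * κ y.2.2.2 + y.2.2.1 * ι x.2.2.2,
        ρ (ι x.2.2.2 * κ y.2.2.2 - κ y.2.2.2 * ι x.2.2.2)))
    (fun x x' y => by
      ext1; · simp [add_mul]
      ext1; · simp [add_mul]; abel
      ext1; · simp [add_mul, mul_add]; abel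
      ext1; · simp [add_mul, mul_add]; abel
      ext1; · simp [add_mul, mul_add]; abel
      ext1; · simp [add_mul, mul_add]; abel
      simp [add_mul, mul_add]; abel)
    (fun t x y => by
      simp [smul_sub, smul_mul_assoc, mul_smul_comm])
    (fun x y y' => by
      ext1; · simp [mul_add]
      ext1; · simp [mul_add]; abel
      ext1; · simp [add_mul, mul_add]; abel
      ext1; · simp [add_mul, mul_add]; abel
      ext1; · simp [add_mul, mul_add]; abel
      ext1; · simp [add_mul, mul_add]; abel
      simp [add_mul, mul_add]; abel)
    (fun t x y => by
      simp [smul_sub, smul_mul_assoc, mul_smul_comm])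

variable {ι : P →ₗ[ℝ] Octonion} {κ : P' →ₗ[ℝ] Octonion} {ρ : Octonion →ₗ[ℝ] Q}

theorem twistedProduct_eq_zero (hι : Function.Injective ι) (hκ : Function.Injective κ)
    (hρ : ∀ p p', ρ (ι p * κ p' - κ p' * ι p) = 0 → ι p * κ p' = κ p' * ι p)
    (x : Octonion × Octonion × Octonion × P) (y : Octonion × Octonion × Octonion × P')
    (h : twistedProduct ι κ ρ x y = 0) : x = 0 ∨ y = 0 := by
  obtain ⟨x₀, x₁, x₂, p⟩ := x
  obtain ⟨y₀, y₁, y₂, p'⟩ := y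
  simp only [twistedProduct, LinearMap.mk₂_apply, Prod.mk_eq_zero] at h
  obtain ⟨h0, h1, h2, h3, h4, h5, h6⟩ := h
  simpa [map_eq_zero_iff ι hι, map_eq_zero_iff κ hκ] using
    eq_zero_or_eq_zero_of_twisted (hρ _ _ h6) h0 h1 h2 h3 h4 h5

variable [Module.Finite ℝ P] [Module.Finite ℝ P'] [Module.Finite ℝ Q]

/-- The twisted product with four coefficients on each side. -/
theorem hasIndependentSections_four_four (hι : Function.Injective ι) (hκ : Function.Injective κ)
    (hρ : ∀ p p', ρ (ι p * κ p' - κ p' * ι p) = 0 → ι p * κ p' = κ p' * ι p) {r s k : ℕ}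
    (hr : 24 + Module.finrank ℝ P = r + 1) (hs : 24 + Module.finrank ℝ P' = s)
    (hk : 48 + Module.finrank ℝ Q = k) :
    HasIndependentSections (Fin k → ℝ) (WhitneyMultiple k (CanonicalLineBundle r)) s := by
  refine hasIndependentSections_of_nonsingular ?_ ?_ ?_ (twistedProduct ι κ ρ)
    (twistedProduct_eq_zero hι hκ hρ) <;>
  · simp only [Module.finrank_prod, finrank_eq_eight]
    omega

/-- Setting `x₀ = 0` makes the first component of the twisted product vanish. -/
theorem hasIndependentSections_three_four (hι : Function.Injective ι)
    (hκ : Function.Injective κ)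
    (hρ : ∀ p p', ρ (ι p * κ p' - κ p' * ι p) = 0 → ι p * κ p' = κ p' * ι p) {r s k : ℕ}
    (hr : 16 + Module.finrank ℝ P = r + 1) (hs : 24 + Module.finrank ℝ P' = s)
    (hk : 40 + Module.finrank ℝ Q = k) :
    HasIndependentSections (Fin k → ℝ) (WhitneyMultiple k (CanonicalLineBundle r)) s := by
  refine hasIndependentSections_of_nonsingular ?_ ?_ ?_
    (((twistedProduct ι κ ρ).comp (LinearMap.inr ℝ Octonion (Octonion × Octonion × P))).compr₂
      (LinearMap.snd ℝ Octonion _)) fun x y h => ?_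
  iterate 3
    simp only [Module.finrank_prod, finrank_eq_eight]
    omega
  have h0 : twistedProduct ι κ ρ (0, x) y = 0 := Prod.ext (zero_mul y.1) h
  simpa using twistedProduct_eq_zero hι hκ hρ _ _ h0

end Bilinear

/-! ### Subspaces with small commutators -/

/-- The quaternions without `k`-component. -/
noncomputable def spanOneIJ : (ℝ × ℝ × ℝ) →ₗ[ℝ] ℍ[ℝ] where
  toFun v := ⟨v.1, v.2.1, v.2.2, 0⟩
  map_add' _ _ := by
    ext
    exacts [rfl, rfl, rfl, (add_zero 0).symm]
  map_smul' t _ := by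
    ext
    exacts [rfl, rfl, rfl, (mul_zero t).symm]

theorem spanOneIJ_injective : Function.Injective spanOneIJ := fun _ _ h =>
  Prod.ext (congrArg QuaternionAlgebra.re h)
    (Prod.ext (congrArg QuaternionAlgebra.imI h) (congrArg QuaternionAlgebra.imJ h))

@[simp] theorem imK_spanOneIJ (v : ℝ × ℝ × ℝ) : (spanOneIJ v).imK = 0 := rfl

/-- The imaginary coordinates of a quaternion. -/
noncomputable def quaternionIm : ℍ[ℝ] →ₗ[ℝ] ℝ × ℝ × ℝ where
  toFun q := (q.imI, q.imJ, q.imK)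
  map_add' _ _ := rfl
  map_smul' _ _ := rfl

/-- The `k`-coordinate of a quaternion. -/
noncomputable def quaternionImK : ℍ[ℝ] →ₗ[ℝ] ℝ where
  toFun q := q.imK
  map_add' _ _ := rfl
  map_smul' _ _ := rfl

/-- The three-dimensional subspace `⟨1, i, j⟩ × 0` of the octonions. -/
noncomputable def threeDim : (ℝ × ℝ × ℝ) →ₗ[ℝ] Octonion :=
  equivProd.symm.toLinearMap ∘ₗ LinearMap.inl ℝ ℍ[ℝ] ℍ[ℝ] ∘ₗ spanOneIJ

/-- The five-dimensional subspace `ℝ × ℍ` of the octonions. -/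
noncomputable def fiveDim : (ℝ × ℍ[ℝ]) →ₗ[ℝ] Octonion :=
  equivProd.symm.toLinearMap ∘ₗ (Algebra.linearMap ℝ ℍ[ℝ]).prodMap LinearMap.id

/-- The seven-dimensional subspace `⟨1, i, j⟩ × ℍ` of the octonions. -/
noncomputable def sevenDim : ((ℝ × ℝ × ℝ) × ℍ[ℝ]) →ₗ[ℝ] Octonion :=
  equivProd.symm.toLinearMap ∘ₗ spanOneIJ.prodMap LinearMap.id

@[simp] theorem fst_threeDim (v) : (threeDim v).fst = spanOneIJ v := rfl
@[simp] theorem snd_threeDim (v) : (threeDim v).snd = 0 := rfl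
@[simp] theorem fst_fiveDim (v) : (fiveDim v).fst = (v.1 : ℍ[ℝ]) := rfl
@[simp] theorem snd_fiveDim (v) : (fiveDim v).snd = v.2 := rfl
@[simp] theorem fst_sevenDim (v) : (sevenDim v).fst = spanOneIJ v.1 := rfl
@[simp] theorem snd_sevenDim (v) : (sevenDim v).snd = v.2 := rfl

theorem threeDim_injective : Function.Injective threeDim := fun _ _ h =>
  spanOneIJ_injective (congrArg fst h)

theorem fiveDim_injective : Function.Injective fiveDim := fun _ _ h =>
  Prod.ext (congrArg (fun x => x.fst.re) h) (congrArg snd h)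

theorem sevenDim_injective : Function.Injective sevenDim := fun _ _ h =>
  Prod.ext (spanOneIJ_injective (congrArg fst h)) (congrArg snd h)

/-- The imaginary coordinates of an octonion. -/
noncomputable def imCoords : Octonion →ₗ[ℝ] (ℝ × ℝ × ℝ) × ℍ[ℝ] :=
  quaternionIm.prodMap LinearMap.id ∘ₗ equivProd.toLinearMap

/-- The imaginary coordinates of the first quaternion of an octonion. -/
noncomputable def fstImCoords : Octonion →ₗ[ℝ] ℝ × ℝ × ℝ :=
  quaternionIm ∘ₗ LinearMap.fst ℝ ℍ[ℝ] ℍ[ℝ] ∘ₗ equivProd.toLinearMap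

/-- The `k`-coordinate of the first quaternion of an octonion. -/
noncomputable def fstImK : Octonion →ₗ[ℝ] ℝ :=
  quaternionImK ∘ₗ LinearMap.fst ℝ ℍ[ℝ] ℍ[ℝ] ∘ₗ equivProd.toLinearMap

/-- The `k`-coordinate of the first quaternion, and the second quaternion. -/
noncomputable def imKSnd : Octonion →ₗ[ℝ] ℝ × ℍ[ℝ] :=
  quaternionImK.prodMap LinearMap.id ∘ₗ equivProd.toLinearMap

theorem fst_re_commutator (x y : Octonion) : (x * y - y * x).fst.re = 0 := by
  simp; ring

theorem commute_of_imCoords (x y : Octonion) (h : imCoords (x * y - y * x) = 0) :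
    x * y = y * x := by
  refine sub_eq_zero.1 ?_
  have h1 := congrArg Prod.fst h
  ext1
  · ext
    exacts [fst_re_commutator x y, congrArg Prod.fst h1, congrArg (fun v => v.2.1) h1,
      congrArg (fun v => v.2.2) h1]
  · exact congrArg Prod.snd h

/-- On `ℝ × ℍ` the second quaternion of a commutator vanishes. -/
theorem commute_fiveDim (p p')
    (h : fstImCoords (fiveDim p * fiveDim p' - fiveDim p' * fiveDim p) = 0) :
    fiveDim p * fiveDim p' = fiveDim p' * fiveDim p := by
  refine commute_of_imCoords _ _ (Prod.ext h ?_)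
  change (fiveDim p * fiveDim p' - fiveDim p' * fiveDim p).snd = 0
  ext <;> simp <;> ring

/-- If `x` lies in `⟨1, i, j⟩ × 0` and `y` in `⟨1, i, j⟩ × ℍ`, the first quaternion of their
commutator is a multiple of `k`. -/
theorem commute_of_imKSnd {x y : Octonion} (hx : x.fst.imK = 0) (hx' : x.snd = 0)
    (hy : y.fst.imK = 0) (h : imKSnd (x * y - y * x) = 0) : x * y = y * x := by
  refine commute_of_imCoords _ _ (Prod.ext ?_ (congrArg Prod.snd h :))
  refine Prod.ext ?_ (Prod.ext ?_ (congrArg Prod.fst h :))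
  · change (x * y - y * x).fst.imI = 0
    simp [hx, hx', hy]; ring
  · change (x * y - y * x).fst.imJ = 0
    simp [hx, hx', hy]; ring

theorem commute_threeDim_sevenDim (p p')
    (h : imKSnd (threeDim p * sevenDim p' - sevenDim p' * threeDim p) = 0) :
    threeDim p * sevenDim p' = sevenDim p' * threeDim p :=
  commute_of_imKSnd (by simp) (by simp) (by simp) h

theorem commute_sevenDim_threeDim (p p')
    (h : imKSnd (sevenDim p * threeDim p' - threeDim p' * sevenDim p) = 0) :
    sevenDim p * threeDim p' = threeDim p' * sevenDim p := by
  refine (commute_threeDim_sevenDim p' p ?_).symm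
  rw [← neg_sub, map_neg, h, neg_zero]

theorem commute_threeDim (p p')
    (h : fstImK (threeDim p * threeDim p' - threeDim p' * threeDim p) = 0) :
    threeDim p * threeDim p' = threeDim p' * threeDim p := by
  refine commute_of_imKSnd (by simp) (by simp) (by simp) (Prod.ext h ?_)
  change (threeDim p * threeDim p' - threeDim p' * threeDim p).snd = 0
  simp

end Octonion

open Octonion in
theorem mainTheorem4 :
    HasIndependentSections (Fin 47 → ℝ) (WhitneyMultiple 47 (CanonicalLineBundle 23)) 32 ∧
    HasIndependentSections (Fin 43 → ℝ) (WhitneyMultiple 43 (CanonicalLineBundle 20)) 29 ∧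
    HasIndependentSections (Fin 41 → ℝ) (WhitneyMultiple 41 (CanonicalLineBundle 18)) 27 ∧
    HasIndependentSections (Fin 45 → ℝ) (WhitneyMultiple 45 (CanonicalLineBundle 18)) 31 ∧
    HasIndependentSections (Fin 45 → ℝ) (WhitneyMultiple 45 (CanonicalLineBundle 22)) 27 ∧
    HasIndependentSections (Fin 51 → ℝ) (WhitneyMultiple 51 (CanonicalLineBundle 28)) 29 := by
  refine ⟨?_, ?_, ?_, ?_, ?_, ?_⟩
  · exact hasIndependentSections_three_four (ι := LinearMap.id) (κ := LinearMap.id)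
      Function.injective_id Function.injective_id commute_of_imCoords
      (by simp [finrank_eq_eight]) (by simp [finrank_eq_eight])
      (by simp [Quaternion.finrank_eq_four])
  · exact hasIndependentSections_three_four fiveDim_injective fiveDim_injective commute_fiveDim
      (by simp [Quaternion.finrank_eq_four]) (by simp [Quaternion.finrank_eq_four]) (by simp)
  · exact hasIndependentSections_three_four threeDim_injective threeDim_injective commute_threeDim
      (by simp) (by simp) (by simp)
  · exact hasIndependentSections_three_four threeDim_injective sevenDim_injective
      commute_threeDim_sevenDim (by simp) (by simp [Quaternion.finrank_eq_four])
      (by simp [Quaternion.finrank_eq_four])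
  · exact hasIndependentSections_three_four sevenDim_injective threeDim_injective
      commute_sevenDim_threeDim (by simp [Quaternion.finrank_eq_four]) (by simp)
      (by simp [Quaternion.finrank_eq_four])
  · exact hasIndependentSections_four_four fiveDim_injective fiveDim_injective commute_fiveDim
      (by simp [Quaternion.finrank_eq_four]) (by simp [Quaternion.finrank_eq_four]) (by simp)
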